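/- \textbf{Setting.} Let $\mathcal S,\mathcal A,\mathcal O$ be finite. Consider a time-homogeneous POMDP with initial state distribution $\nu$, transition kernel $P(s'\mid s,a)$, observation kernel $Z(o\mid s)$, reward $r(s,a)$ with values in a finite set $\mathcal R\subset\mathbb R$, and discount factor $\gamma\in[0,1)$. Let $\pi^e(a\mid o)$ be the evaluation policy, $J(\pi^e)=\mathbb E_{\pi^e}[\sum_{t\ge0}\gamma^tR_t]$ its value, and let $\nu_{\mathcal O}(o)=\sum_s Z(o\mid s)\nu(s)$ be the (known) initial observation distribution. One observed tuple $(O^-,A,O,R,O^+)$ is generated by $(O^-,S)\sim P_{\pi^b}$ (an arbitrary law on $\mathcal O\times\mathcal S$), $O\sim Z(\cdot\mid S)$, $A\sim\pi^b(\cdot\mid S)$, $R=r(S,A)$, $S^+\sim P(\cdot\mid S,A)$, $O^+\sim Z(\cdot\mid S^+)$, where the behavior policy $\pi^b$ depends only on the unobserved state. Let $p_0$ be the law of the observed tuple. For a law $p$ on $\mathcal O\times\mathcal A\times\mathcal O\times\mathcal R\times\mathcal O$, a learnable value bridge function is a solution $b_V:\mathcal A\times\mathcal O\to\mathbb R$ of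 $$\mathbb E_p[b_V(A,O)\mid A,O^-]=\mathbb E_p[R\,\pi^e(A\mid O)\mid A,O^-]+\gamma\,\mathbb E_p\Big[\sum_{a'}b_V(a',O^+)\pi^e(A\mid O)\,\Big|\,A,O^-\Big],$$ and a learnable weight bridge function is a solution $b_W:\mathcal A\times\mathcal O\to\mathbb R$ of $$\mathbb E_p\Big[\gamma\, b_W(A,O^-)\pi^e(A\mid O)\sum_{a'}f(O^+,a')-b_W(A,O^-)f(O,A)\Big]+(1-\gamma)\,\mathbb E_{\tilde O\sim\nu_{\mathcal O}}\Big[\sum_{a'}f(\tilde O,a')\Big]=0\quad\text{for all } f:\mathcal O\times\mathcal A\to\mathbb R.$$ Let $\mathcal M$ be the otherwise unrestricted model of all laws $p$ of the observed tuple for which $\operatorname{rank}(\Pr_p(\mathbf O\mid A=a,\mathbf O^-))=|\mathcal O|$ for every $a$ and for which both learnable bridge functions exist and are unique. On $\mathcal M$ the estimand is $\psi(p)=\mathbb E_{\tilde O\sim\nu_{\mathcal O}}[\sum_a b_V^p(a,\tilde O)]$, where $b_V^p$ is the learnable value bridge function under $p$. The Cramér–Rao (semiparametric efficiency) lower bound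 at $p_0$ is the supremum, over all regular (differentiable in quadratic mean at $\theta=0$) one-dimensional submodels $\theta\mapsto p_\theta\in\mathcal M$ through $p_0$ at $\theta=0$ with Fisher information $I>0$, of the parametric bound $(\partial_\theta\psi(p_\theta)|_{\theta=0})^2/I$ (and $0$ if there is no such submodel). \textbf{Theorem.} Assume $\operatorname{rank}(\Pr_{\pi^b}(\mathbf O\mid A=a,\mathbf O^-))=|\mathcal S|=|\mathcal O|$ for every $a\in\mathcal A$. Then $p_0\in\mathcal M$ (in particular the learnable bridge functions $b_V,b_W$ under $p_0$ exist and are unique), $\psi(p_0)=J(\pi^e)$, $\psi$ is differentiable at $\theta=0$ along every regular submodel of $\mathcal M$ through $p_0$, and the Cramér–Rao lower bound for estimating $J(\pi^e)$ equals $$V_{\mathrm{EIF}}=\mathbb E\big[(J(b_W,b_V)-J(\pi^e))^2\big],$$ where, for $f,g:\mathcal A\times\mathcal O\to\mathbb R$, $$J(f,g)=\mathbb E_{\tilde O\sim\nu_{\mathcal O}}\Big[\sum_a g(a,\tilde O)\Big]+\frac{f(A,O^-)}{1-\gamma}\Big[\Big\{R+\gamma\sum_{a'}g(a',O^+)\Big\}\pi^e(A\mid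 O)-g(A,O)\Big].$$ -/

import Mathlib

open Topology
open scoped ENNReal

noncomputable section

/-! ### Regular parametric submodels and the Cramér–Rao (semiparametric efficiency) bound

Laws on a finite sample space `X` are probability mass functions `X → ℝ`; a statistical model is a
set of laws; the estimand is a real functional of the law. -/

namespace Efficiency

variable {X : Type*} [Fintype X]

/-- Expectation of `f` under the probability mass function `p`. -/
def expect (p : X → ℝ) (f : X → ℝ) : ℝ := ∑ x, p x * f x

/-- A regular one-dimensional parametric submodel `θ ↦ p θ` of the model `Mdl` through `p₀`:
it passes through `p₀` at `θ = 0`, stays in the model for all `θ` near `0` (on both sides), and is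
differentiable in quadratic mean at `0` (on a finite sample space: each `√(p θ x)` is
differentiable in `θ` at `0`). -/
structure IsRegularSubmodel (Mdl : Set (X → ℝ)) (p₀ : X → ℝ) (p : ℝ → X → ℝ) : Prop where
  at_zero : p 0 = p₀
  mem : ∀ᶠ θ in 𝓝 (0 : ℝ), p θ ∈ Mdl
  qmd : ∀ x, DifferentiableAt ℝ (fun θ => √(p θ x)) 0

/-- The score `∂/∂θ log p θ x` at `θ = 0`. -/
def score (p : ℝ → X → ℝ) (x : X) : ℝ := deriv (fun θ => Real.log (p θ x)) 0

/-- The Fisher information at `θ = 0`: the second moment of the score under `p 0`. -/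
def fisherInfo (p : ℝ → X → ℝ) : ℝ := expect (p 0) (fun x => score p x ^ 2)

/-- The Cramér–Rao lower bound (per observation) for estimating the functional `ψ` at `p₀` in the
model `Mdl`: the supremum, over all regular one-dimensional submodels with positive information, of
the parametric Cramér–Rao bound `(∂ψ(p θ)/∂θ)² / I` at `θ = 0`. -/
def cramerRaoBound (Mdl : Set (X → ℝ)) (ψ : (X → ℝ) → ℝ) (p₀ : X → ℝ) : ℝ≥0∞ :=
  ⨆ (p : ℝ → X → ℝ) (_ : IsRegularSubmodel Mdl p₀ p) (_ : 0 < fisherInfo p),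
    ENNReal.ofReal ((deriv (fun θ => ψ (p θ)) 0) ^ 2 / fisherInfo p)

end Efficiency

namespace ConfoundedPOMDP

open Efficiency

/-- A tabular time-homogeneous discounted POMDP with state, action and observation spaces
`S`, `A`, `O`; `Rw` is a finite set of reals in which the rewards `r(s,a)` lie. -/
structure POMDP (S A O : Type*) [Fintype S] [Fintype A] [Fintype O] (Rw : Finset ℝ) where
  /-- initial state distribution -/
  init : S → ℝ
  init_mem : init ∈ stdSimplex ℝ S
  /-- `trans s a s'` is the probability of moving from `s` to `s'` under action `a` -/
  trans : S → A → S → ℝ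
  trans_mem : ∀ s a, trans s a ∈ stdSimplex ℝ S
  /-- `emit s o` is the probability of observing `o` in state `s` -/
  emit : S → O → ℝ
  emit_mem : ∀ s, emit s ∈ stdSimplex ℝ O
  reward : S → A → Rw
  /-- discount factor -/
  disc : ℝ
  disc_nonneg : 0 ≤ disc
  disc_lt_one : disc < 1

/-- The observed tuples `(O⁻, A, O, R, O⁺)`. -/
abbrev Obs (A O : Type*) (Rw : Finset ℝ) := O × A × O × Rw × O

variable {S A O : Type*} [Fintype S] [Fintype A] [Fintype O] {Rw : Finset ℝ}

/-- Probability of the trajectory `(S₀,O₀,A₀,…,S_t,O_t,A_t)` under an observation-based evaluation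
policy `pe` (`pe o a` is the probability of action `a` given observation `o`). -/
def POMDP.trajProb (M : POMDP S A O Rw) (pe : O → A → ℝ) (t : ℕ)
    (s : Fin (t + 1) → S) (o : Fin (t + 1) → O) (a : Fin (t + 1) → A) : ℝ :=
  M.init (s 0) * (∏ k : Fin t, M.trans (s k.castSucc) (a k.castSucc) (s k.succ)) *
    ∏ k : Fin (t + 1), M.emit (s k) (o k) * pe (o k) (a k)

/-- `E_{πᵉ}[R_t]`. -/
def POMDP.meanReward (M : POMDP S A O Rw) (pe : O → A → ℝ) (t : ℕ) : ℝ :=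
  ∑ s : Fin (t + 1) → S, ∑ o : Fin (t + 1) → O, ∑ a : Fin (t + 1) → A,
    M.trajProb pe t s o a * (M.reward (s (Fin.last t)) (a (Fin.last t)) : ℝ)

/-- The policy value `J(πᵉ) = E_{πᵉ}[∑_{t ≥ 0} γ^t R_t]`. -/
def POMDP.policyValue (M : POMDP S A O Rw) (pe : O → A → ℝ) : ℝ :=
  ∑' t : ℕ, M.disc ^ t * M.meanReward pe t

/-- The initial observation distribution `ν_O`. -/
def POMDP.initObs (M : POMDP S A O Rw) (o : O) : ℝ := ∑ s, M.emit s o * M.init s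

/-- Law of the observed tuple `(O⁻, A, O, R, O⁺)` when `(O⁻,S) ∼ d`, `O ∼ Z(·|S)`, `A ∼ πᵇ(·|S)`,
`R = r(S,A)`, `S⁺ ∼ P(·|S,A)`, `O⁺ ∼ Z(·|S⁺)`. -/
def POMDP.obsLaw (M : POMDP S A O Rw) (d : O × S → ℝ) (pb : S → A → ℝ) : Obs A O Rw → ℝ :=
  fun (om, a, o, ρ, op) =>
    ∑ s, d (om, s) * M.emit s o * pb s a * (if M.reward s a = ρ then 1 else 0) *
      ∑ s', M.trans s a s' * M.emit s' op

/-- `Pr_p(A = a, O⁻ = om)`. -/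
def probAOm (p : Obs A O Rw → ℝ) (a : A) (om : O) : ℝ :=
  ∑ o, ∑ ρ, ∑ op, p (om, a, o, ρ, op)

/-- Conditional expectation `E_p[f | A = a, O⁻ = om]` (equal to `0` on null events). -/
def condMean (p : Obs A O Rw → ℝ) (f : Obs A O Rw → ℝ) (a : A) (om : O) : ℝ :=
  (∑ o, ∑ ρ, ∑ op, p (om, a, o, ρ, op) * f (om, a, o, ρ, op)) / probAOm p a om

/-- The matrix `Pr_p(𝐎 | A = a, 𝐎⁻)`, with entries `Pr_p(O = i | A = a, O⁻ = j)`. -/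
def condMatrix (p : Obs A O Rw → ℝ) (a : A) : Matrix O O ℝ :=
  Matrix.of fun i j => (∑ ρ, ∑ op, p (j, a, i, ρ, op)) / probAOm p a j

/-- `b` is a learnable value bridge function under the observed law `p`:
`E[b(A,O) | A,O⁻] = E[R πᵉ(A|O) | A,O⁻] + γ E[∑_{a'} b(a',O⁺) πᵉ(A|O) | A,O⁻]`. -/
def IsValueBridge (γ : ℝ) (pe : O → A → ℝ) (p : Obs A O Rw → ℝ) (b : A → O → ℝ) : Prop :=
  ∀ a om,
    condMean p (fun (_, a, o, _, _) => b a o) a om =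
      condMean p (fun (_, a, o, ρ, _) => (ρ : ℝ) * pe o a) a om +
      γ * condMean p (fun (_, a, o, _, op) => ∑ a', b a' op * pe o a) a om

/-- The loss `L_W(g,f)` as a function of the observed tuple. -/
def weightLoss (γ : ℝ) (pe : O → A → ℝ) (nuO : O → ℝ) (g : A → O → ℝ) (f : O → A → ℝ) :
    Obs A O Rw → ℝ :=
  fun (om, a, o, _, op) =>
    (∑ a', γ * g a om * pe o a * f op a') - g a om * f o a +
      (1 - γ) * ∑ o', nuO o' * ∑ a', f o' a'

/-- `b` is a learnable weight bridge function under the observed law `p`: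
`E[L_W(b,f)] = 0` for all `f`. -/
def IsWeightBridge (γ : ℝ) (pe : O → A → ℝ) (nuO : O → ℝ) (p : Obs A O Rw → ℝ)
    (b : A → O → ℝ) : Prop :=
  ∀ f : O → A → ℝ, expect p (weightLoss γ pe nuO b f) = 0

/-- The doubly robust function `J(f,g)` of the observed tuple. -/
def drFun (γ : ℝ) (pe : O → A → ℝ) (nuO : O → ℝ) (f g : A → O → ℝ) : Obs A O Rw → ℝ :=
  fun (om, a, o, ρ, op) =>
    (∑ o', nuO o' * ∑ a', g a' o') +
      f a om / (1 - γ) * (((ρ : ℝ) + γ * ∑ a', g a' op) * pe o a - g a o)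

/-- The (otherwise unrestricted) model for the law of the observed tuple: all laws that satisfy the
rank condition and under which the learnable bridge functions exist and are unique. -/
def observedModel (γ : ℝ) (pe : O → A → ℝ) (nuO : O → ℝ) : Set (Obs A O Rw → ℝ) :=
  {p | p ∈ stdSimplex ℝ (Obs A O Rw) ∧ (∀ a, (condMatrix p a).rank = Fintype.card O) ∧
    (∃! b, IsValueBridge γ pe p b) ∧ ∃! b, IsWeightBridge γ pe nuO p b}

open Classical in
/-- The estimand as a functional of the observed law: `E_{Õ ∼ ν_O}[∑_a b_V(a,Õ)]` with `b_V` the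
learnable value bridge function under `p` (unique on `observedModel`; default value `0`). -/
def valueFunctional (γ : ℝ) (pe : O → A → ℝ) (nuO : O → ℝ) (p : Obs A O Rw → ℝ) : ℝ :=
  if h : ∃ b, IsValueBridge γ pe p b then ∑ o, nuO o * ∑ a, h.choose a o else 0

end ConfoundedPOMDP

end

/-! ### The Cramér–Rao bound in a relatively open model -/

namespace Efficiency

/-! Multiplying the value bridge equation by `Pr_p(A, O⁻)` turns it into a square linear system `T_p
b = r_p` on functions of `(A, O)`, with `T_p` and `r_p` linear in `p` (`bridgeOp`, `rewardVec`). The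
weight bridge equation is the adjoint system `wᵀ T_p = (1 - γ) νᵀ`, where `ν(a, o) = ν_O(o)`. Both
are uniquely solvable as soon as `T_p` is invertible, and then `ψ(p) = ν · T_p⁻¹ r_p`.

At the true law, the rank condition with `|S| = |O|` lets `O⁻` identify every function of the state
(`eq_of_sum_mul_eq`). The bridge equation therefore holds conditionally on `S`; summed over actions
it becomes the latent Bellman equation (`bridgeValue_eq`). Discounting makes that equation a
contraction, which yields invertibility of `T` (`bridgeOp_obsLaw_injective`) and `ψ = J(πᵉ)`
(`policyValue_eq`).

Invertibility and full rank are open conditions, so the model is a neighbourhood of the true law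
within the simplex (`observedModel_mem_nhdsWithin`) and every centred score is available. In such a
model the bound is the second moment of any centred gradient (`cramerRaoBound_eq_of_gradient`). The
gradient comes from duality (`hasDerivAt_valueFunctional`): with `w` the weight bridge at `p₀` and
`b_θ` the value bridge at `p_θ`, the difference `ψ(p_θ) - ψ(p₀)` is exactly `(1 - γ)⁻¹ ∑ (p_θ - p₀)
ρ(w, b_θ)`, where `ρ` is the weighted bridge residual. Hence continuity of `b_θ` is enough to
differentiate. -/

theorem score_eq_div {X : Type*} {p : ℝ → X → ℝ} {p' : X → ℝ} {x : X}
    (hp : HasDerivAt (fun θ => p θ x) (p' x) 0) (hx : p 0 x ≠ 0) :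
    score p x = p' x / p 0 x :=
  (hp.log hx).deriv

variable {X : Type*} [Fintype X]

/-- A differentiable-in-quadratic-mean path of probability mass functions is differentiable, and its
derivative vanishes off the support of the base point. -/
theorem IsRegularSubmodel.exists_hasDerivAt {Mdl : Set (X → ℝ)} {p₀ : X → ℝ} {p : ℝ → X → ℝ}
    (hM : Mdl ⊆ stdSimplex ℝ X) (h : IsRegularSubmodel Mdl p₀ p) :
    ∃ p' : X → ℝ, (∀ x, HasDerivAt (fun θ => p θ x) (p' x) 0) ∧ ∀ x, p₀ x = 0 → p' x = 0 := by
  have hsq : ∀ x, (fun θ => p θ x) =ᶠ[𝓝 0] fun θ => √(p θ x) ^ 2 := fun x =>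
    h.mem.mono fun θ hθ => (Real.sq_sqrt ((hM hθ).1 x)).symm
  refine ⟨fun x => 2 * √(p₀ x) * deriv (fun θ => √(p θ x)) 0, fun x => ?_, fun x hx => by simp [hx]⟩
  have := ((h.qmd x).hasDerivAt.pow 2).congr_of_eventuallyEq (hsq x)
  simpa [h.at_zero] using this

theorem sum_deriv_eq_zero {p : ℝ → X → ℝ} {p' : X → ℝ}
    (hp : ∀ x, HasDerivAt (fun θ => p θ x) (p' x) 0) (hs : ∀ᶠ θ in 𝓝 0, p θ ∈ stdSimplex ℝ X) :
    ∑ x, p' x = 0 := by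
  have h1 : HasDerivAt (fun θ => ∑ x, p θ x) (∑ x, p' x) 0 := HasDerivAt.fun_sum fun x _ => hp x
  have h2 : (fun θ => ∑ x, p θ x) =ᶠ[𝓝 0] fun _ => (1 : ℝ) := hs.mono fun θ hθ => hθ.2
  exact h1.unique ((hasDerivAt_const (0 : ℝ) (1 : ℝ)).congr_of_eventuallyEq h2)

theorem expect_mul_sq_le (p f g : X → ℝ) (hp : ∀ x, 0 ≤ p x) :
    expect p (fun x => f x * g x) ^ 2 ≤
      expect p (fun x => f x ^ 2) * expect p (fun x => g x ^ 2) := by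
  have := Finset.sum_mul_sq_le_sq_mul_sq Finset.univ (fun x => √(p x) * f x) fun x => √(p x) * g x
  simp only [mul_pow, Real.sq_sqrt (hp _)] at this
  have h : expect p (fun x => f x * g x) = ∑ x, √(p x) * f x * (√(p x) * g x) :=
    Finset.sum_congr rfl fun x _ => by
      linear_combination (-(f x * g x)) * Real.sq_sqrt (hp x)
  rwa [h]

/-- In a model that is a relative neighbourhood of `p₀` in the simplex, the Cramér–Rao bound of a
functional with gradient `φ` centred at `p₀` is the second moment of `φ`. -/
theorem cramerRaoBound_eq_of_gradient {Mdl : Set (X → ℝ)} {ψ : (X → ℝ) → ℝ} {p₀ φ : X → ℝ}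
    (hM : Mdl ⊆ stdSimplex ℝ X) (hnhds : Mdl ∈ 𝓝[stdSimplex ℝ X] p₀)
    (hp₀ : p₀ ∈ stdSimplex ℝ X) (hφ : expect p₀ φ = 0)
    (hgrad : ∀ (p : ℝ → X → ℝ) (p' : X → ℝ), p 0 = p₀ →
      (∀ x, HasDerivAt (fun θ => p θ x) (p' x) 0) → (∀ᶠ θ in 𝓝 0, p θ ∈ Mdl) →
      HasDerivAt (fun θ => ψ (p θ)) (∑ x, p' x * φ x) 0) :
    cramerRaoBound Mdl ψ p₀ = ENNReal.ofReal (expect p₀ fun x => φ x ^ 2) := by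
  apply le_antisymm
  · refine iSup_le fun p => iSup_le fun hp => iSup_le fun hI => ENNReal.ofReal_le_ofReal ?_
    obtain ⟨p', hp', hz⟩ := hp.exists_hasDerivAt hM
    have hder : ∑ x, p' x * φ x = expect p₀ (fun x => score p x * φ x) := by
      refine Finset.sum_congr rfl fun x _ => ?_
      -- The score carries no information off the support, but there the derivative of the path
      -- vanishes too.
      by_cases hx : p₀ x = 0
      · simp [hx, hz x hx]
      · have := score_eq_div (hp' x) (by rwa [hp.at_zero])
        simp only [this, hp.at_zero]
        field_simp
    rw [(hgrad p p' hp.at_zero hp' hp.mem).deriv, div_le_iff₀ hI, hder, mul_comm, fisherInfo,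
      hp.at_zero]
    exact expect_mul_sq_le _ _ _ hp₀.1
  · have hnn : 0 ≤ expect p₀ fun x => φ x ^ 2 :=
      Finset.sum_nonneg fun x _ => mul_nonneg (hp₀.1 x) (sq_nonneg (φ x))
    -- If `φ` has zero second moment, the claimed bound is `0` and no submodel has to be exhibited.
    rcases hnn.eq_or_lt with h0 | hpos
    · simp [← h0]
    -- The least favourable path: its score is `φ` on the support, so Cauchy–Schwarz is an equality
    -- along it.
    let p : ℝ → X → ℝ := fun θ x => p₀ x * (1 + θ * φ x)
    have hp0 : p 0 = p₀ := by ext; simp [p]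
    have hp' : ∀ x, HasDerivAt (fun θ => p θ x) (p₀ x * φ x) 0 := fun x => by
      simpa [p] using (((hasDerivAt_id (0 : ℝ)).mul_const (φ x)).const_add 1).const_mul (p₀ x)
    have hone : ∀ᶠ θ in 𝓝 (0 : ℝ), ∀ x, 0 ≤ 1 + θ * φ x := by
      rw [Filter.eventually_all]
      intro x
      have hc : ContinuousAt (fun θ : ℝ => 1 + θ * φ x) 0 := by fun_prop
      exact (hc.eventually (lt_mem_nhds (by simp))).mono fun _ h => le_of_lt h
    have hs : ∀ᶠ θ in 𝓝 (0 : ℝ), p θ ∈ stdSimplex ℝ X := hone.mono fun θ hθ =>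
      ⟨fun x => mul_nonneg (hp₀.1 x) (hθ x), by
        have : ∑ x, p θ x = ∑ x, p₀ x + θ * expect p₀ φ := by
          simp only [p, expect, Finset.mul_sum, ← Finset.sum_add_distrib]
          exact Finset.sum_congr rfl fun x _ => by ring
        rw [this, hφ, hp₀.2]; simp⟩
    have hmem : ∀ᶠ θ in 𝓝 (0 : ℝ), p θ ∈ Mdl := by
      have hc : ContinuousAt p 0 := continuousAt_pi.2 fun x => (hp' x).continuousAt
      have ht : Filter.Tendsto p (𝓝 0) (𝓝[stdSimplex ℝ X] p₀) :=
        tendsto_nhdsWithin_iff.2 ⟨by simpa [ContinuousAt, hp0] using hc, hs⟩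
      exact ht hnhds
    have hreg : IsRegularSubmodel Mdl p₀ p := by
      refine ⟨hp0, hmem, fun x => ?_⟩
      -- The square root is not differentiable at zero, but the path is constantly zero at such
      -- points.
      by_cases hx : p₀ x = 0
      · simp [p, hx]
      · exact (hp' x).differentiableAt.sqrt (by rwa [hp0])
    have hI : fisherInfo p = expect p₀ fun x => φ x ^ 2 := by
      unfold fisherInfo expect
      rw [hp0]
      refine Finset.sum_congr rfl fun x _ => ?_
      by_cases hx : p₀ x = 0
      · simp [hx]
      · simp only [score_eq_div (p' := fun x => p₀ x * φ x) (hp' x) (by rwa [hp0]), hp0]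
        field_simp
    have hd : deriv (fun θ => ψ (p θ)) 0 = expect p₀ fun x => φ x ^ 2 := by
      rw [(hgrad p _ hp0 hp' hmem).deriv]
      exact Finset.sum_congr rfl fun x _ => by ring
    refine le_iSup_of_le p (le_iSup_of_le hreg (le_iSup_of_le (hI ▸ hpos) ?_))
    rw [hd, hI, sq, mul_div_assoc, div_self hpos.ne', mul_one]

end Efficiency

/-- Since `f` vanishes at `x`, the slope of the product is the slope of `f` times `g`, so `g` need
not be differentiable. -/
theorem HasDerivAt.mul_of_eq_zero {f g : ℝ → ℝ} {f' x : ℝ} (hf : HasDerivAt f f' x)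
    (hx : f x = 0) (hg : ContinuousAt g x) :
    HasDerivAt (fun y => f y * g y) (f' * g x) x := by
  rw [hasDerivAt_iff_tendsto_slope] at hf ⊢
  refine (hf.mul (hg.tendsto.mono_left nhdsWithin_le_nhds)).congr fun y => ?_
  simp [slope_def_field, hx, div_mul_eq_mul_div]

theorem Matrix.isUnit_of_rank_eq_card {n : Type*} [Fintype n] [DecidableEq n] {M : Matrix n n ℝ}
    (h : M.rank = Fintype.card n) : IsUnit M := by
  rw [← Matrix.mulVec_surjective_iff_isUnit, ← Matrix.coe_mulVecLin, ← LinearMap.range_eq_top]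
  apply Submodule.eq_top_of_finrank_eq
  rwa [Module.finrank_fintype_fun_eq_card]

/-! ### The bridge equations as a linear system and its adjoint -/

namespace ConfoundedPOMDP

open Efficiency

variable {A O : Type*} [Fintype A] [Fintype O] {Rw : Finset ℝ}

theorem expect_eq_sum (p f : Obs A O Rw → ℝ) :
    expect p f = ∑ x : A × O, ∑ o, ∑ ρ, ∑ op,
      p (x.2, x.1, o, ρ, op) * f (x.2, x.1, o, ρ, op) := by
  rw [expect, Fintype.sum_prod_type, Fintype.sum_prod_type_right]
  simp only [Fintype.sum_prod_type]

/-- The linear operator of the bridge equations, scaled by `Pr_p(A, O⁻)`: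
`b ↦ E_p[(b(A,O) - γ πᵉ(A|O) ∑_{a'} b(a',O⁺)) 1(A = a, O⁻ = j)]`. -/
def bridgeOp (γ : ℝ) (pe : O → A → ℝ) (p : Obs A O Rw → ℝ) :
    (A × O → ℝ) →ₗ[ℝ] (A × O → ℝ) where
  toFun b := fun x => ∑ o, ∑ ρ, ∑ op, p (x.2, x.1, o, ρ, op) *
    (b (x.1, o) - γ * ∑ a', b (a', op) * pe o x.1)
  map_add' b c := by
    ext x
    simp only [Pi.add_apply, ← Finset.sum_add_distrib]
    simp only [← Finset.sum_mul, Finset.sum_add_distrib]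
    simp only [← Finset.sum_add_distrib]
    refine Finset.sum_congr rfl fun o _ => Finset.sum_congr rfl fun ρ _ =>
      Finset.sum_congr rfl fun op _ => ?_
    rw [Finset.sum_add_distrib]; ring
  map_smul' r b := by
    ext x
    simp only [Pi.smul_apply, smul_eq_mul, Finset.mul_sum, RingHom.id_apply]
    refine Finset.sum_congr rfl fun o _ => Finset.sum_congr rfl fun ρ _ =>
      Finset.sum_congr rfl fun op _ => ?_
    simp only [← Finset.sum_mul, ← Finset.mul_sum, mul_assoc]; ring

/-- The right-hand side of the value bridge equation, scaled by `Pr_p(A, O⁻)`. -/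
def rewardVec (pe : O → A → ℝ) (p : Obs A O Rw → ℝ) : A × O → ℝ :=
  fun x => ∑ o, ∑ ρ, ∑ op, p (x.2, x.1, o, ρ, op) * ((ρ : ℝ) * pe o x.1)

theorem continuous_rewardVec {A O : Type*} [Fintype O] {Rw : Finset ℝ} (pe : O → A → ℝ) :
    Continuous fun p : Obs A O Rw → ℝ => rewardVec pe p := by
  unfold rewardVec
  fun_prop

theorem isValueBridge_iff {γ : ℝ} {pe : O → A → ℝ} {p : Obs A O Rw → ℝ}
    (hp : ∀ a j, probAOm p a j ≠ 0) (b : A → O → ℝ) :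
    IsValueBridge γ pe p b ↔ bridgeOp γ pe p (Function.uncurry b) = rewardVec pe p := by
  simp only [IsValueBridge, funext_iff, Prod.forall]
  refine forall_congr' fun a => forall_congr' fun j => ?_
  have : bridgeOp γ pe p (Function.uncurry b) (a, j) =
      (∑ o, ∑ ρ, ∑ op, p (j, a, o, ρ, op) * b a o) -
        γ * ∑ o, ∑ ρ, ∑ op, p (j, a, o, ρ, op) * ∑ a', b a' op * pe o a := by
    simp only [bridgeOp, LinearMap.coe_mk, AddHom.coe_mk, Function.uncurry_apply_pair, mul_sub,
      Finset.sum_sub_distrib, Finset.mul_sum, mul_left_comm]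
  rw [this]
  simp only [condMean, rewardVec]
  rw [mul_div_assoc', ← add_div, div_left_inj' (hp a j), sub_eq_iff_eq_add]

/-- The integrand of the bridge equations weighted by `w`. -/
def weightedResidual (γ : ℝ) (pe : O → A → ℝ) (w b : A × O → ℝ) : Obs A O Rw → ℝ :=
  fun (j, a, o, ρ, op) => w (a, j) * ((ρ : ℝ) * pe o a - (b (a, o) - γ * ∑ a', b (a', op) * pe o a))

/-- The pairing that links the two systems: it vanishes for every `w` when `b` solves the value
equation, while a weight bridge `w` evaluates its last term as a multiple of `initMean`. -/
theorem expect_weightedResidual (γ : ℝ) (pe : O → A → ℝ) (w b : A × O → ℝ) (p : Obs A O Rw → ℝ) :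
    expect p (weightedResidual γ pe w b) = w ⬝ᵥ rewardVec pe p - w ⬝ᵥ bridgeOp γ pe p b := by
  rw [expect_eq_sum, dotProduct, dotProduct, ← Finset.sum_sub_distrib]
  refine Finset.sum_congr rfl fun x _ => ?_
  simp only [rewardVec, bridgeOp, LinearMap.coe_mk, AddHom.coe_mk, weightedResidual, Prod.mk.eta]
  rw [← mul_sub]
  simp only [← Finset.sum_sub_distrib]
  simp only [Finset.mul_sum (s := (Finset.univ : Finset O)) (a := w x),
    Finset.mul_sum (s := (Finset.univ : Finset Rw)) (a := w x)]
  refine Finset.sum_congr rfl fun o _ => Finset.sum_congr rfl fun ρ _ =>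
    Finset.sum_congr rfl fun op _ => ?_
  ring

/-- `f ↦ E_{Õ ∼ ν_O}[∑_a f(a,Õ)]`. -/
def initMean (nuO : O → ℝ) (f : A × O → ℝ) : ℝ := ∑ o, nuO o * ∑ a, f (a, o)

theorem initMean_eq_dotProduct (nuO : O → ℝ) (f : A × O → ℝ) :
    initMean nuO f = (fun x => nuO x.2) ⬝ᵥ f := by
  simp only [initMean, dotProduct, Fintype.sum_prod_type_right, Finset.mul_sum]

theorem drFun_eq (γ : ℝ) (pe : O → A → ℝ) (nuO : O → ℝ) (f g : A → O → ℝ) (x : Obs A O Rw) :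
    drFun γ pe nuO f g x = initMean nuO (Function.uncurry g) +
      (1 - γ)⁻¹ * weightedResidual γ pe (Function.uncurry f) (Function.uncurry g) x := by
  obtain ⟨j, a, o, ρ, op⟩ := x
  simp only [drFun, initMean, weightedResidual, Function.uncurry_apply_pair, ← Finset.sum_mul]
  ring

theorem isWeightBridge_iff {γ : ℝ} {pe : O → A → ℝ} {nuO : O → ℝ} {p : Obs A O Rw → ℝ}
    (hp : ∑ x, p x = 1) (w : A → O → ℝ) :
    IsWeightBridge γ pe nuO p w ↔
      ∀ f, Function.uncurry w ⬝ᵥ bridgeOp γ pe p f = (1 - γ) * initMean nuO f := by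
  have key : ∀ f : A × O → ℝ, expect p (weightLoss γ pe nuO w fun o a => f (a, o)) =
      (1 - γ) * initMean nuO f - Function.uncurry w ⬝ᵥ bridgeOp γ pe p f := by
    intro f
    have h1 := expect_weightedResidual γ pe (Function.uncurry w) f p
    have h0 := expect_weightedResidual γ pe (Function.uncurry w) 0 p
    rw [map_zero, dotProduct_zero, sub_zero] at h0
    have : (1 - γ) * initMean nuO f = ∑ x, p x * ((1 - γ) * initMean nuO f) := by
      rw [← Finset.sum_mul, hp, one_mul]
    -- Subtracting the residual at `f` from the one at `0` cancels the reward term.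
    rw [show Function.uncurry w ⬝ᵥ bridgeOp γ pe p f =
      expect p (weightedResidual γ pe (Function.uncurry w) 0) -
        expect p (weightedResidual γ pe (Function.uncurry w) f) by rw [h0, h1]; ring, this]
    simp only [expect, ← Finset.sum_sub_distrib]
    refine Finset.sum_congr rfl fun x _ => ?_
    obtain ⟨j, a, o, ρ, op⟩ := x
    simp only [weightLoss, weightedResidual, initMean, Function.uncurry_apply_pair, Pi.zero_apply,
      mul_assoc, ← Finset.mul_sum, ← Finset.sum_mul]
    ring
  constructor
  · intro h f
    have := h fun o a => f (a, o)
    rw [key] at this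
    linarith
  · intro h f
    have := key fun x => f x.2 x.1
    rw [h] at this
    simpa using this

/-- Division by zero returns zero, so a null event `(A = a, O⁻ = j)` would give a zero column. The
rank condition thus contains positivity. -/
theorem probAOm_ne_zero_of_isUnit {A O : Type*} [Fintype O] [DecidableEq O] {Rw : Finset ℝ}
    {p : Obs A O Rw → ℝ} {a : A}
    (h : IsUnit (condMatrix p a)) (j : O) : probAOm p a j ≠ 0 := by
  intro h0
  have h1 := (Matrix.isUnit_iff_isUnit_det _).1 h
  rw [Matrix.det_eq_zero_of_column_eq_zero j fun i => by simp [condMatrix, h0]] at h1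
  simp at h1

/-! ### Invertible bridge systems: openness of the model and the gradient -/

section matrix

variable [DecidableEq A] [DecidableEq O]

/-- The matrix of `bridgeOp`. -/
def bridgeMatrix (γ : ℝ) (pe : O → A → ℝ) (p : Obs A O Rw → ℝ) : Matrix (A × O) (A × O) ℝ :=
  LinearMap.toMatrix' (bridgeOp γ pe p)

theorem bridgeMatrix_mulVec (γ : ℝ) (pe : O → A → ℝ) (p : Obs A O Rw → ℝ) (f : A × O → ℝ) :
    (bridgeMatrix γ pe p).mulVec f = bridgeOp γ pe p f :=
  LinearMap.toMatrix'_mulVec _ _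

theorem continuous_bridgeMatrix (γ : ℝ) (pe : O → A → ℝ) :
    Continuous fun p : Obs A O Rw → ℝ => bridgeMatrix γ pe p := by
  refine continuous_matrix fun i j => ?_
  simp only [bridgeMatrix, LinearMap.toMatrix'_apply, bridgeOp, LinearMap.coe_mk, AddHom.coe_mk]
  fun_prop

/-- The solution of the (scaled) value bridge equation. -/
noncomputable def valueBridge (γ : ℝ) (pe : O → A → ℝ) (p : Obs A O Rw → ℝ) : A × O → ℝ :=
  (bridgeMatrix γ pe p)⁻¹.mulVec (rewardVec pe p)

variable {γ : ℝ} {pe : O → A → ℝ} {nuO : O → ℝ} {p₀ p : Obs A O Rw → ℝ}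

theorem bridgeOp_eq_rewardVec_iff (h : (bridgeMatrix γ pe p).det ≠ 0) (b : A × O → ℝ) :
    bridgeOp γ pe p b = rewardVec pe p ↔ b = valueBridge γ pe p := by
  rw [← bridgeMatrix_mulVec, valueBridge]
  constructor
  · intro hb
    rw [← hb, Matrix.mulVec_mulVec, Matrix.nonsing_inv_mul _ h.isUnit, Matrix.one_mulVec]
  · rintro rfl
    rw [Matrix.mulVec_mulVec, Matrix.mul_nonsing_inv _ h.isUnit, Matrix.one_mulVec]

theorem continuousAt_valueBridge (h : (bridgeMatrix γ pe p₀).det ≠ 0) :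
    ContinuousAt (fun p : Obs A O Rw → ℝ => valueBridge γ pe p) p₀ := by
  have hc := continuous_bridgeMatrix (Rw := Rw) γ pe
  have hd := hc.matrix_det
  have hi : ContinuousAt (fun p : Obs A O Rw → ℝ => (bridgeMatrix γ pe p)⁻¹) p₀ := by
    simp only [Matrix.inv_def, Ring.inverse_eq_inv']
    exact (hd.continuousAt.inv₀ h).smul hc.matrix_adjugate.continuousAt
  have hm : Continuous fun q : Matrix (A × O) (A × O) ℝ × (A × O → ℝ) => q.1.mulVec q.2 :=
    continuous_fst.matrix_mulVec continuous_snd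
  exact hm.continuousAt.comp (hi.prodMk (continuous_rewardVec pe).continuousAt)

theorem existsUnique_isValueBridge (hp : ∀ a j, probAOm p a j ≠ 0)
    (h : (bridgeMatrix γ pe p).det ≠ 0) : ∃! b, IsValueBridge γ pe p b := by
  refine ⟨Function.curry (valueBridge γ pe p), ?_, fun b hb => ?_⟩
  · simp only [isValueBridge_iff hp, Function.uncurry_curry, bridgeOp_eq_rewardVec_iff h]
  · simp only [isValueBridge_iff hp, bridgeOp_eq_rewardVec_iff h] at hb
    rw [← hb, Function.curry_uncurry]

theorem existsUnique_isWeightBridge (hp : ∑ x, p x = 1)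
    (h : (bridgeMatrix γ pe p).det ≠ 0) : ∃! b, IsWeightBridge γ pe nuO p b := by
  simp only [isWeightBridge_iff hp, initMean_eq_dotProduct, ← bridgeMatrix_mulVec,
    Matrix.dotProduct_mulVec, ← smul_eq_mul (1 - γ), ← smul_dotProduct]
  simp only [dotProduct_eq_iff]
  refine ⟨Function.curry (Matrix.vecMul ((1 - γ) • fun x : A × O => nuO x.2)
    (bridgeMatrix γ pe p)⁻¹), ?_, fun w hw => ?_⟩
  · simp only [Function.uncurry_curry]
    rw [Matrix.vecMul_vecMul, Matrix.nonsing_inv_mul _ h.isUnit, Matrix.vecMul_one]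
  · simp only at hw
    rw [← hw, Matrix.vecMul_vecMul, Matrix.mul_nonsing_inv _ h.isUnit, Matrix.vecMul_one,
      Function.curry_uncurry]

theorem valueFunctional_eq (hp : ∀ a j, probAOm p a j ≠ 0)
    (h : (bridgeMatrix γ pe p).det ≠ 0) :
    valueFunctional γ pe nuO p = initMean nuO (valueBridge γ pe p) := by
  have he := (existsUnique_isValueBridge hp h).exists
  have hb := (isValueBridge_iff hp _).1 he.choose_spec
  rw [bridgeOp_eq_rewardVec_iff h] at hb
  rw [valueFunctional, dif_pos he, ← hb]
  rfl

theorem mem_observedModel (hp : p ∈ stdSimplex ℝ (Obs A O Rw))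
    (hr : ∀ a, IsUnit (condMatrix p a)) (h : (bridgeMatrix γ pe p).det ≠ 0) :
    p ∈ observedModel γ pe nuO :=
  ⟨hp, fun a => Matrix.rank_of_isUnit _ (hr a),
    existsUnique_isValueBridge (fun a => probAOm_ne_zero_of_isUnit (hr a)) h,
    existsUnique_isWeightBridge hp.2 h⟩

/-- Both determinants are nonzero at `p₀` and continuous there; for `condMatrix` this uses that its
denominators do not vanish at `p₀`. -/
theorem observedModel_mem_nhdsWithin (hr : ∀ a, IsUnit (condMatrix p₀ a))
    (h : (bridgeMatrix γ pe p₀).det ≠ 0) :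
    observedModel γ pe nuO ∈ 𝓝[stdSimplex ℝ (Obs A O Rw)] p₀ := by
  have h1 : ∀ᶠ p in 𝓝 p₀, (bridgeMatrix γ pe p).det ≠ 0 :=
    (continuous_bridgeMatrix (Rw := Rw) γ pe).matrix_det.continuousAt.eventually_ne h
  have h2 : ∀ᶠ p in 𝓝 p₀, ∀ a, IsUnit (condMatrix p a) := by
    rw [Filter.eventually_all]
    intro a
    have hc : ContinuousAt (fun p : Obs A O Rw → ℝ => condMatrix p a) p₀ := by
      refine continuousAt_pi.2 fun i => continuousAt_pi.2 fun j => ?_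
      refine ContinuousAt.div (Continuous.continuousAt (by fun_prop))
        (Continuous.continuousAt ?_) (probAOm_ne_zero_of_isUnit (hr a) j)
      unfold probAOm
      fun_prop
    have hd : ContinuousAt (fun p : Obs A O Rw → ℝ => (condMatrix p a).det) p₀ :=
      (continuous_id.matrix_det.continuousAt).comp hc
    have := (Matrix.isUnit_iff_isUnit_det _).1 (hr a)
    exact (hd.eventually_ne this.ne_zero).mono fun p hp =>
      (Matrix.isUnit_iff_isUnit_det _).2 hp.isUnit
  filter_upwards [nhdsWithin_le_nhds h1, nhdsWithin_le_nhds h2, self_mem_nhdsWithin]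
    with p h1 h2 h3 using mem_observedModel h3 h2 h1

/-- The doubly robust function is a gradient of the estimand. -/
theorem hasDerivAt_valueFunctional (hγ : γ ≠ 1) {p : ℝ → Obs A O Rw → ℝ} {p' : Obs A O Rw → ℝ}
    (hp' : ∀ x, HasDerivAt (fun θ => p θ x) (p' x) 0)
    (hmem : ∀ᶠ θ in 𝓝 0, p θ ∈ observedModel γ pe nuO)
    (hdet : (bridgeMatrix γ pe (p 0)).det ≠ 0) {bW bV : A → O → ℝ}
    (hW : IsWeightBridge γ pe nuO (p 0) bW) (hV : IsValueBridge γ pe (p 0) bV) :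
    HasDerivAt (fun θ => valueFunctional γ pe nuO (p θ))
      (∑ x, p' x * drFun γ pe nuO bW bV x) 0 := by
  have hpos : ∀ q ∈ observedModel (Rw := Rw) γ pe nuO, ∀ a j, probAOm q a j ≠ 0 :=
    fun q hq a => probAOm_ne_zero_of_isUnit (Matrix.isUnit_of_rank_eq_card (hq.2.1 a))
  have h0 := hmem.self_of_nhds
  have hγ' : 1 - γ ≠ 0 := sub_ne_zero.2 hγ.symm
  have hc : ContinuousAt p 0 := continuousAt_pi.2 fun x => (hp' x).continuousAt
  rw [isWeightBridge_iff h0.1.2] at hW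
  rw [isValueBridge_iff (hpos _ h0)] at hV
  have hV' := (bridgeOp_eq_rewardVec_iff hdet _).1 hV
  have hb : ContinuousAt (fun θ => valueBridge γ pe (p θ)) 0 :=
    (continuousAt_valueBridge hdet).comp hc
  have hd : ∀ᶠ θ in 𝓝 0, (bridgeMatrix γ pe (p θ)).det ≠ 0 :=
    ((continuous_bridgeMatrix (Rw := Rw) γ pe).matrix_det.continuousAt.comp hc).eventually_ne hdet
  -- Exact expansion: the residual at `b_θ` has mean zero under `p θ`, and under `p 0` the weight
  -- bridge turns its mean into `(1 - γ)(ψ(p 0) - ψ(p θ))`.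
  have hexp : (fun θ => valueFunctional γ pe nuO (p θ)) =ᶠ[𝓝 0] fun θ =>
      initMean nuO (Function.uncurry bV) + (1 - γ)⁻¹ * ∑ x, (p θ x - p 0 x) *
        weightedResidual γ pe (Function.uncurry bW) (valueBridge γ pe (p θ)) x := by
    filter_upwards [hmem, hd] with θ hm hd
    have e1 := expect_weightedResidual γ pe (Function.uncurry bW) (valueBridge γ pe (p θ)) (p θ)
    rw [(bridgeOp_eq_rewardVec_iff hd _).2 rfl, sub_self] at e1
    have e2 := expect_weightedResidual γ pe (Function.uncurry bW) (valueBridge γ pe (p θ)) (p 0)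
    rw [← hV, hW, hW] at e2
    simp only [sub_mul, Finset.sum_sub_distrib]
    rw [valueFunctional_eq (hpos _ hm) hd]
    unfold expect at e1 e2
    rw [e1, e2]
    field_simp
    ring
  refine HasDerivAt.congr_of_eventuallyEq ?_ hexp
  have hs := sum_deriv_eq_zero hp' (hmem.mono fun θ h => h.1)
  -- The constant part of `drFun` drops out because the derivatives of the masses sum to zero.
  have : ∑ x, p' x * drFun γ pe nuO bW bV x = (1 - γ)⁻¹ * ∑ x, p' x *
      weightedResidual γ pe (Function.uncurry bW) (valueBridge γ pe (p 0)) x := by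
    simp only [drFun_eq, mul_add, Finset.sum_add_distrib, ← Finset.sum_mul, hs, zero_mul, zero_add,
      Finset.mul_sum, hV', mul_left_comm]
  rw [this]
  refine ((HasDerivAt.fun_sum fun x _ => HasDerivAt.mul_of_eq_zero ((hp' x).sub_const _)
    (sub_self _) ?_).const_mul _).const_add _
  obtain ⟨j, a, o, ρ, op⟩ := x
  have hb' : ∀ y, ContinuousAt (fun θ => valueBridge γ pe (p θ) y) 0 := continuousAt_pi.1 hb
  simp only [weightedResidual]
  fun_prop (disch := assumption)

end matrix

end ConfoundedPOMDP

/-! ### Latent policy evaluation and the policy value -/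

namespace ConfoundedPOMDP

open Efficiency

namespace POMDP

variable {S A O : Type*} [Fintype S] [Fintype A] [Fintype O] {Rw : Finset ℝ}
  (M : POMDP S A O Rw)

/-- Conditional mean of a function of the observation given the state. -/
def emitMean (f : O → ℝ) (s : S) : ℝ := ∑ o, M.emit s o * f o

/-- The one-step operator `u ↦ E_{πᵉ}[u(S₁) | S₀ = s]`. -/
def stepOp (pe : O → A → ℝ) : Module.End ℝ (S → ℝ) where
  toFun u := fun s => ∑ a, M.emitMean (fun o => pe o a) s * ∑ s', M.trans s a s' * u s'
  map_add' u v := by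
    ext s
    simp only [Pi.add_apply, mul_add, Finset.sum_add_distrib]
  map_smul' r u := by
    ext s
    simp only [Pi.smul_apply, smul_eq_mul, Finset.mul_sum, RingHom.id_apply, mul_left_comm]

theorem stepOp_apply (pe : O → A → ℝ) (u : S → ℝ) (s : S) : M.stepOp pe u s =
    ∑ a, M.emitMean (fun o => pe o a) s * ∑ s', M.trans s a s' * u s' :=
  rfl

/-- The expected reward given the state under the evaluation policy. -/
def stateReward (pe : O → A → ℝ) (s : S) : ℝ :=
  ∑ a, M.emitMean (fun o => pe o a) s * (M.reward s a : ℝ)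

theorem emitMean_const (c : ℝ) (s : S) : M.emitMean (fun _ => c) s = c := by
  rw [emitMean, ← Finset.sum_mul, (M.emit_mem s).2, one_mul]

theorem norm_stepOp_le {pe : O → A → ℝ} (hpe : ∀ o, pe o ∈ stdSimplex ℝ A) (u : S → ℝ) :
    ‖M.stepOp pe u‖ ≤ ‖u‖ := by
  refine (pi_norm_le_iff_of_nonneg (norm_nonneg u)).2 fun s => ?_
  have h1 : ∀ a, ‖∑ s', M.trans s a s' * u s'‖ ≤ ‖u‖ := fun a => by
    calc ‖∑ s', M.trans s a s' * u s'‖ ≤ ∑ s', M.trans s a s' * ‖u‖ := by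
          refine norm_sum_le_of_le _ fun s' _ => ?_
          rw [norm_mul, Real.norm_of_nonneg ((M.trans_mem s a).1 s')]
          exact mul_le_mul_of_nonneg_left (norm_le_pi_norm u s') ((M.trans_mem s a).1 s')
      _ = ‖u‖ := by rw [← Finset.sum_mul, (M.trans_mem s a).2, one_mul]
  have hnn : ∀ a, 0 ≤ M.emitMean (fun o => pe o a) s := fun a =>
    Finset.sum_nonneg fun o _ => mul_nonneg ((M.emit_mem s).1 o) ((hpe o).1 a)
  have hsum : ∑ a, M.emitMean (fun o => pe o a) s = 1 := by
    simp only [emitMean]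
    rw [Finset.sum_comm]
    simp only [← Finset.mul_sum, (hpe _).2, mul_one, (M.emit_mem s).2]
  calc ‖M.stepOp pe u s‖ ≤ ∑ a, M.emitMean (fun o => pe o a) s * ‖u‖ := by
        refine norm_sum_le_of_le _ fun a _ => ?_
        rw [norm_mul, Real.norm_of_nonneg (hnn a)]
        exact mul_le_mul_of_nonneg_left (h1 a) (hnn a)
    _ = ‖u‖ := by rw [← Finset.sum_mul, hsum, one_mul]

theorem norm_stepOp_pow_le {pe : O → A → ℝ} (hpe : ∀ o, pe o ∈ stdSimplex ℝ A) (u : S → ℝ)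
    (t : ℕ) : ‖(M.stepOp pe ^ t) u‖ ≤ ‖u‖ := by
  induction t with
  | zero => simp
  | succ t ih =>
    rw [pow_succ', Module.End.mul_apply]
    exact (M.norm_stepOp_le hpe _).trans ih

theorem sum_fin_cons {B : Type*} [Fintype B] {n : ℕ} (F : (Fin (n + 1) → B) → ℝ) :
    ∑ x, F x = ∑ b, ∑ x : Fin n → B, F (Fin.cons b x) := by
  rw [← (Fin.consEquiv fun _ => B).sum_comp, Fintype.sum_prod_type]
  rfl

/-- Induction peels off the first time step. The initial weights `h` are arbitrary so that the
hypothesis applies to the tail with weights `M.trans s₀ a₀`. -/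
theorem sum_trajectory (pe : O → A → ℝ) (t : ℕ) (h : S → ℝ) :
    ∑ s : Fin (t + 1) → S, ∑ o : Fin (t + 1) → O, ∑ a : Fin (t + 1) → A,
      (h (s 0) * (∏ k : Fin t, M.trans (s k.castSucc) (a k.castSucc) (s k.succ)) *
        ∏ k : Fin (t + 1), M.emit (s k) (o k) * pe (o k) (a k)) *
          (M.reward (s (Fin.last t)) (a (Fin.last t)) : ℝ) =
      ∑ s, h s * (M.stepOp pe ^ t) (M.stateReward pe) s := by
  induction t generalizing h with
  | zero =>
    simp only [sum_fin_cons, Finset.univ_unique, Finset.sum_singleton]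
    simp only [Fin.cons_zero, Fin.last_zero, Finset.univ_eq_empty, Finset.prod_empty,
      Fin.prod_univ_succ, pow_zero, Module.End.one_apply, stateReward, emitMean, mul_one]
    refine Finset.sum_congr rfl fun s _ => ?_
    rw [Finset.sum_comm, Finset.mul_sum]
    refine Finset.sum_congr rfl fun a _ => ?_
    rw [Finset.sum_mul, Finset.mul_sum]
    exact Finset.sum_congr rfl fun o _ => by ring
  | succ t ih =>
    simp only [sum_fin_cons (n := t + 1)]
    have key : ∀ s₀ o₀ a₀,
        ∑ s : Fin (t + 1) → S, ∑ o : Fin (t + 1) → O, ∑ a : Fin (t + 1) → A,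
          (h s₀ * (M.trans s₀ a₀ (s 0) *
            ∏ k : Fin t, M.trans (s k.castSucc) (a k.castSucc) (s k.succ)) *
            ((M.emit s₀ o₀ * pe o₀ a₀) *
              ∏ k : Fin (t + 1), M.emit (s k) (o k) * pe (o k) (a k))) *
            (M.reward (s (Fin.last t)) (a (Fin.last t)) : ℝ) =
        h s₀ * (M.emit s₀ o₀ * pe o₀ a₀ *
          ∑ s, M.trans s₀ a₀ s * (M.stepOp pe ^ t) (M.stateReward pe) s) := by
      intro s₀ o₀ a₀
      rw [← ih (M.trans s₀ a₀)]
      simp only [Finset.mul_sum]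
      refine Finset.sum_congr rfl fun s _ => Finset.sum_congr rfl fun o _ =>
        Finset.sum_congr rfl fun a _ => ?_
      ring
    simp only [Fin.prod_univ_succ (n := t), Fin.prod_univ_succ (n := t + 1), Fin.cons_zero,
      Fin.cons_succ, Fin.castSucc_zero, ← Fin.succ_castSucc, ← Fin.succ_last]
    refine Finset.sum_congr rfl fun s₀ _ => ?_
    have swap : ∀ G : (Fin (t + 1) → S) → O → (Fin (t + 1) → O) → A → (Fin (t + 1) → A) → ℝ,
        ∑ s, ∑ o₀, ∑ o, ∑ a₀, ∑ a, G s o₀ o a₀ a =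
          ∑ a₀, ∑ o₀, ∑ s, ∑ o, ∑ a, G s o₀ o a₀ a := by
      intro G
      simp only [Finset.sum_comm (s := (Finset.univ : Finset (Fin (t + 1) → O)))
        (t := (Finset.univ : Finset A))]
      rw [Finset.sum_comm]
      simp only [Finset.sum_comm (s := (Finset.univ : Finset (Fin (t + 1) → S)))
        (t := (Finset.univ : Finset A))]
      rw [Finset.sum_comm]
    rw [swap, pow_succ', Module.End.mul_apply]
    rw [stepOp_apply, Finset.mul_sum]
    refine Finset.sum_congr rfl fun a₀ _ => ?_
    rw [emitMean, Finset.sum_mul, Finset.mul_sum]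
    refine Finset.sum_congr rfl fun o₀ _ => ?_
    rw [← key s₀ o₀ a₀]
    simp only [Fin.prod_univ_succ (n := t)]

theorem meanReward_eq (pe : O → A → ℝ) (t : ℕ) :
    M.meanReward pe t = ∑ s, M.init s * (M.stepOp pe ^ t) (M.stateReward pe) s :=
  M.sum_trajectory pe t M.init

/-- A solution of the latent policy evaluation equation averages to the policy value. -/
theorem policyValue_eq {pe : O → A → ℝ} (hpe : ∀ o, pe o ∈ stdSimplex ℝ A) {V : S → ℝ}
    (hV : V = M.stateReward pe + M.disc • M.stepOp pe V) :
    M.policyValue pe = ∑ s, M.init s * V s := by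
  let u : ℕ → ℝ := fun t => M.disc ^ t * ∑ s, M.init s * (M.stepOp pe ^ t) V s
  have hu : Summable u := by
    refine Summable.of_norm_bounded (g := fun t => M.disc ^ t * ‖V‖)
      ((summable_geometric_of_lt_one M.disc_nonneg M.disc_lt_one).mul_right _) fun t => ?_
    rw [norm_mul, norm_pow, Real.norm_of_nonneg M.disc_nonneg]
    refine mul_le_mul_of_nonneg_left ?_ (pow_nonneg M.disc_nonneg t)
    calc ‖∑ s, M.init s * (M.stepOp pe ^ t) V s‖ ≤ ∑ s, M.init s * ‖V‖ := by
          refine norm_sum_le_of_le _ fun s _ => ?_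
          rw [norm_mul, Real.norm_of_nonneg (M.init_mem.1 s)]
          exact mul_le_mul_of_nonneg_left
            ((norm_le_pi_norm _ s).trans (M.norm_stepOp_pow_le hpe V t)) (M.init_mem.1 s)
      _ = ‖V‖ := by rw [← Finset.sum_mul, M.init_mem.2, one_mul]
  have hr : M.stateReward pe = V - M.disc • M.stepOp pe V := eq_sub_of_add_eq hV.symm
  -- The reward is `V - γ P V`, with `P` the one-step operator, so the discounted series telescopes
  -- to `u 0`.
  have hterm : ∀ t, M.disc ^ t * M.meanReward pe t = u t - u (t + 1) := fun t => by
    rw [meanReward_eq, hr, map_sub, map_smul, ← Module.End.mul_apply, ← pow_succ]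
    simp only [u, Pi.sub_apply, Pi.smul_apply, smul_eq_mul, mul_sub, Finset.sum_sub_distrib,
      Finset.mul_sum]
    congr 1
    exact Finset.sum_congr rfl fun s _ => by ring
  rw [policyValue, tsum_congr hterm, hu.tsum_sub ((summable_nat_add_iff 1).2 hu),
    hu.tsum_eq_zero_add]
  simp [u]

/-- The step operator does not increase the sup norm, so `γ < 1` makes the right-hand side a strict
contraction. -/
theorem eq_zero_of_eq_disc_smul_stepOp {pe : O → A → ℝ} (hpe : ∀ o, pe o ∈ stdSimplex ℝ A)
    {V : S → ℝ} (hV : V = M.disc • M.stepOp pe V) : V = 0 := by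
  have h : ‖V‖ ≤ M.disc * ‖V‖ := by
    calc ‖V‖ = M.disc * ‖M.stepOp pe V‖ := by
          conv_lhs => rw [hV]
          rw [norm_smul, Real.norm_of_nonneg M.disc_nonneg]
      _ ≤ M.disc * ‖V‖ := mul_le_mul_of_nonneg_left (M.norm_stepOp_le hpe V) M.disc_nonneg
  have := M.disc_lt_one
  exact norm_eq_zero.1 (le_antisymm (by nlinarith [norm_nonneg V]) (norm_nonneg V))

/-! ### Moments of the observed law through the latent state -/

theorem sum_obsLaw_mul (d : O × S → ℝ) (pb : S → A → ℝ) (j : O) (a : A) (F : O → Rw → O → ℝ) :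
    ∑ o, ∑ ρ, ∑ op, M.obsLaw d pb (j, a, o, ρ, op) * F o ρ op =
      ∑ s, d (j, s) * pb s a * M.emitMean (fun o =>
        ∑ s', M.trans s a s' * M.emitMean (fun op => F o (M.reward s a) op) s') s := by
  have h1 : ∀ o ρ op, M.obsLaw d pb (j, a, o, ρ, op) * F o ρ op =
      ∑ s, if M.reward s a = ρ then d (j, s) * M.emit s o * pb s a *
        (∑ s', M.trans s a s' * M.emit s' op) * F o ρ op else 0 := fun o ρ op => by
    rw [obsLaw, Finset.sum_mul]
    refine Finset.sum_congr rfl fun s _ => ?_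
    split_ifs <;> ring
  simp only [h1]
  have h2 : ∀ o, ∑ ρ, ∑ op, ∑ s, (if M.reward s a = ρ then d (j, s) * M.emit s o * pb s a *
        (∑ s', M.trans s a s' * M.emit s' op) * F o ρ op else 0) =
      ∑ s, ∑ op, d (j, s) * M.emit s o * pb s a *
        (∑ s', M.trans s a s' * M.emit s' op) * F o (M.reward s a) op := fun o => by
    rw [Finset.sum_congr rfl fun ρ _ => Finset.sum_comm, Finset.sum_comm]
    refine Finset.sum_congr rfl fun s _ => ?_
    rw [Finset.sum_comm]
    simp
  simp only [h2]
  rw [Finset.sum_comm]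
  refine Finset.sum_congr rfl fun s _ => ?_
  rw [emitMean, Finset.mul_sum]
  refine Finset.sum_congr rfl fun o _ => ?_
  simp only [emitMean, Finset.mul_sum, Finset.sum_mul]
  rw [Finset.sum_comm]
  exact Finset.sum_congr rfl fun s' _ => Finset.sum_congr rfl fun op _ => by ring

theorem obsLaw_mem {d : O × S → ℝ} {pb : S → A → ℝ} (hd : d ∈ stdSimplex ℝ (O × S))
    (hpb : ∀ s, pb s ∈ stdSimplex ℝ A) : M.obsLaw d pb ∈ stdSimplex ℝ (Obs A O Rw) := by
  constructor
  · rintro ⟨j, a, o, ρ, op⟩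
    refine Finset.sum_nonneg fun s _ => mul_nonneg (mul_nonneg (mul_nonneg (mul_nonneg (hd.1 _)
      ((M.emit_mem s).1 o)) ((hpb s).1 a)) ?_) (Finset.sum_nonneg fun s' _ =>
        mul_nonneg ((M.trans_mem s a).1 s') ((M.emit_mem s').1 op))
    split_ifs <;> norm_num
  · have h : ∀ j a, ∑ o, ∑ ρ, ∑ op, M.obsLaw d pb (j, a, o, ρ, op) =
        ∑ s, d (j, s) * pb s a := fun j a => by
      simpa only [emitMean_const, mul_one, (M.trans_mem _ _).2] using
        M.sum_obsLaw_mul d pb j a fun _ _ _ => 1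
    have h' : ∀ j, ∑ a, ∑ s, d (j, s) * pb s a = ∑ s, d (j, s) := fun j => by
      rw [Finset.sum_comm]
      simp only [← Finset.mul_sum, (hpb _).2, mul_one]
    rw [← hd.2]
    simp only [Fintype.sum_prod_type, h, h']

theorem emitMean_sub (f g : O → ℝ) (s : S) :
    M.emitMean (fun o => f o - g o) s = M.emitMean f s - M.emitMean g s := by
  simp only [emitMean, mul_sub, Finset.sum_sub_distrib]

theorem emitMean_const_mul (c : ℝ) (f : O → ℝ) (s : S) :
    M.emitMean (fun o => c * f o) s = c * M.emitMean f s := by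
  simp only [emitMean, Finset.mul_sum, mul_left_comm]

theorem emitMean_mul_const (f : O → ℝ) (c : ℝ) (s : S) :
    M.emitMean (fun o => f o * c) s = M.emitMean f s * c := by
  simp only [emitMean, Finset.sum_mul, mul_assoc]

theorem emitMean_sum {ι : Type*} [Fintype ι] (f : ι → O → ℝ) (s : S) :
    M.emitMean (fun o => ∑ i, f i o) s = ∑ i, M.emitMean (f i) s := by
  simp only [emitMean, Finset.mul_sum]
  exact Finset.sum_comm

theorem sum_trans_mul_const (s : S) (a : A) (c : ℝ) : ∑ s', M.trans s a s' * c = c := by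
  rw [← Finset.sum_mul, (M.trans_mem s a).2, one_mul]

/-- The latent state value attached to `b`. -/
def bridgeValue (b : A × O → ℝ) (s : S) : ℝ := ∑ a, M.emitMean (fun o => b (a, o)) s

/-- Given `S`, the observation `O` is independent of `(O⁻, A, O⁺)`, so `πᵉ(a|O)` averages separately
from the future value. -/
theorem bridgeOp_obsLaw (pe : O → A → ℝ) (d : O × S → ℝ) (pb : S → A → ℝ) (b : A × O → ℝ)
    (a : A) (j : O) :
    bridgeOp M.disc pe (M.obsLaw d pb) b (a, j) = ∑ s, d (j, s) * (pb s a *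
      (M.emitMean (fun o => b (a, o)) s - M.disc * (M.emitMean (fun o => pe o a) s *
        ∑ s', M.trans s a s' * M.bridgeValue b s'))) := by
  refine (M.sum_obsLaw_mul d pb j a fun o ρ op =>
    b (a, o) - M.disc * ∑ a', b (a', op) * pe o a).trans ?_
  refine Finset.sum_congr rfl fun s _ => ?_
  rw [mul_assoc]
  congr 2
  have h1 : ∀ o s', M.emitMean (fun op => b (a, o) - M.disc * ∑ a', b (a', op) * pe o a) s' =
      b (a, o) - M.disc * pe o a * M.bridgeValue b s' := fun o s' => by
    simp only [emitMean_sub, emitMean_const, emitMean_const_mul, emitMean_sum, emitMean_mul_const,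
      ← Finset.sum_mul, bridgeValue]
    ring
  have h2 : ∀ o, ∑ s', M.trans s a s' * (b (a, o) - M.disc * pe o a * M.bridgeValue b s') =
      b (a, o) - M.disc * (pe o a * ∑ s', M.trans s a s' * M.bridgeValue b s') := fun o => by
    simp only [mul_sub, Finset.sum_sub_distrib, sum_trans_mul_const, Finset.mul_sum]
    congr 1
    exact Finset.sum_congr rfl fun s' _ => by ring
  simp only [h1, h2, emitMean_sub, emitMean_const_mul, emitMean_mul_const]

theorem rewardVec_obsLaw (pe : O → A → ℝ) (d : O × S → ℝ) (pb : S → A → ℝ) (a : A) (j : O) :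
    rewardVec pe (M.obsLaw d pb) (a, j) = ∑ s, d (j, s) * (pb s a *
      (M.emitMean (fun o => pe o a) s * (M.reward s a : ℝ))) := by
  refine (M.sum_obsLaw_mul d pb j a fun o ρ _ => (ρ : ℝ) * pe o a).trans ?_
  refine Finset.sum_congr rfl fun s _ => ?_
  simp only [emitMean_const, sum_trans_mul_const, emitMean_const_mul]
  ring

theorem initMean_initObs (b : A × O → ℝ) :
    initMean M.initObs b = ∑ s, M.init s * M.bridgeValue b s := by
  simp only [initMean, initObs, bridgeValue, ← emitMean_sum]
  simp only [emitMean, Finset.sum_mul, Finset.mul_sum (s := (Finset.univ : Finset O))]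
  rw [Finset.sum_comm]
  exact Finset.sum_congr rfl fun s _ => Finset.sum_congr rfl fun o _ => by ring

/-! ### Completeness and invertibility at the true law -/

section completeness

variable {M} {pe : O → A → ℝ} {d : O × S → ℝ} {pb : S → A → ℝ}

/-- The matrix acts on `y` only through `E[y(O) | S]`; its invertibility therefore forces the
emission map to be injective. -/
theorem vecMul_condMatrix_obsLaw (a : A) (y : O → ℝ) (j : O) :
    Matrix.vecMul y (condMatrix (M.obsLaw d pb) a) j =
      (∑ s, d (j, s) * (pb s a * M.emitMean y s)) / probAOm (M.obsLaw d pb) a j := by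
  have h := M.sum_obsLaw_mul d pb j a fun o _ _ => y o
  simp only [emitMean_const, sum_trans_mul_const, mul_assoc] at h
  change _ = ∑ s, d (j, s) * (pb s a * M.emitMean y s) at h
  rw [← h]
  simp only [Matrix.vecMul, dotProduct, condMatrix, Matrix.of_apply, Finset.sum_div,
    Finset.mul_sum]
  refine Finset.sum_congr rfl fun o _ => Finset.sum_congr rfl fun ρ _ =>
    Finset.sum_congr rfl fun op _ => ?_
  ring

variable [DecidableEq O]

theorem eq_zero_of_sum_mul_emitMean_eq_zero {a : A}
    (h : IsUnit (condMatrix (M.obsLaw d pb) a)) {y : O → ℝ}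
    (hy : ∀ j, ∑ s, d (j, s) * (pb s a * M.emitMean y s) = 0) : y = 0 := by
  apply Matrix.vecMul_injective_of_isUnit h
  ext j
  beta_reduce
  rw [vecMul_condMatrix_obsLaw, hy, zero_div, Matrix.zero_vecMul, Pi.zero_apply]

theorem eq_zero_of_emitMean_eq_zero {a : A} (h : IsUnit (condMatrix (M.obsLaw d pb) a))
    {y : O → ℝ} (hy : M.emitMean y = 0) : y = 0 :=
  eq_zero_of_sum_mul_emitMean_eq_zero h fun j => by simp [hy]

/-- With as many observations as states, invertibility of the conditional matrix makes functions of
the state identifiable from `O⁻` and of the form `E[y(O) | S]`. -/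
theorem eq_of_sum_mul_eq (hcard : Fintype.card S = Fintype.card O)
    {a : A} (h : IsUnit (condMatrix (M.obsLaw d pb) a)) {u v : S → ℝ}
    (huv : ∀ j, ∑ s, d (j, s) * (pb s a * u s) = ∑ s, d (j, s) * (pb s a * v s)) : u = v := by
  let E : (O → ℝ) →ₗ[ℝ] (S → ℝ) := Matrix.mulVecLin (Matrix.of M.emit)
  have hE : Function.Surjective E := by
    -- Here `|S| = |O|` is essential: the injective emission map is onto, so every function of the
    -- state is some `E[y(O) | S]`.
    rw [← LinearMap.injective_iff_surjective_of_finrank_eq_finrank (by simp [hcard]),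
      injective_iff_map_eq_zero]
    exact fun y hy => eq_zero_of_emitMean_eq_zero h hy
  obtain ⟨y, hy⟩ := hE (u - v)
  have hy' : M.emitMean y = u - v := hy
  have := eq_zero_of_sum_mul_emitMean_eq_zero h (y := y) fun j => by
    simp only [hy', Pi.sub_apply, mul_sub, Finset.sum_sub_distrib, huv, sub_self]
  rw [this, map_zero] at hy
  exact (sub_eq_zero.1 hy.symm)

/-- Completeness removes the average over `S` given `O⁻`, action by action; summing the latent
equations over actions gives the Bellman equation. -/
theorem bridgeValue_eq (hcard : Fintype.card S = Fintype.card O)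
    (h : ∀ a, IsUnit (condMatrix (M.obsLaw d pb) a)) {b : A × O → ℝ}
    (hb : bridgeOp M.disc pe (M.obsLaw d pb) b = rewardVec pe (M.obsLaw d pb)) :
    M.bridgeValue b = M.stateReward pe + M.disc • M.stepOp pe (M.bridgeValue b) := by
  have key : ∀ a, (fun s => M.emitMean (fun o => b (a, o)) s - M.disc *
      (M.emitMean (fun o => pe o a) s * ∑ s', M.trans s a s' * M.bridgeValue b s')) =
      fun s => M.emitMean (fun o => pe o a) s * (M.reward s a : ℝ) := fun a =>
    eq_of_sum_mul_eq hcard (h a) fun j => by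
      have := congrFun hb (a, j)
      rwa [bridgeOp_obsLaw, rewardVec_obsLaw] at this
  ext s
  simp only [Pi.add_apply, Pi.smul_apply, smul_eq_mul, stateReward, stepOp_apply]
  rw [← sub_eq_iff_eq_add, Finset.mul_sum]
  conv_lhs => rw [bridgeValue]
  rw [← Finset.sum_sub_distrib]
  exact Finset.sum_congr rfl fun a _ => congrFun (key a) s

/-- For a kernel element the latent value solves the homogeneous Bellman equation and is zero. Then
`E[b(a,O) | S] = 0` for each `a`, and injectivity of the emission map gives `b = 0`. -/
theorem bridgeOp_obsLaw_injective (hpe : ∀ o, pe o ∈ stdSimplex ℝ A)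
    (hcard : Fintype.card S = Fintype.card O)
    (h : ∀ a, IsUnit (condMatrix (M.obsLaw d pb) a)) :
    Function.Injective (bridgeOp M.disc pe (M.obsLaw d pb)) := by
  rw [injective_iff_map_eq_zero]
  intro b hb
  have key : ∀ a s, M.emitMean (fun o => b (a, o)) s = M.disc *
      (M.emitMean (fun o => pe o a) s * ∑ s', M.trans s a s' * M.bridgeValue b s') := by
    intro a s
    have : (fun s => M.emitMean (fun o => b (a, o)) s - M.disc * (M.emitMean (fun o => pe o a) s *
        ∑ s', M.trans s a s' * M.bridgeValue b s')) = 0 :=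
      eq_of_sum_mul_eq hcard (h a) fun j => by
        have := congrFun hb (a, j)
        rw [bridgeOp_obsLaw] at this
        simpa only [Pi.zero_apply, mul_zero, Finset.sum_const_zero] using this
    exact sub_eq_zero.1 (congrFun this s)
  have hV : M.bridgeValue b = 0 := M.eq_zero_of_eq_disc_smul_stepOp hpe <| by
    ext s
    simp only [Pi.smul_apply, smul_eq_mul, stepOp_apply,
      Finset.mul_sum (s := (Finset.univ : Finset A)), ← key]
    rfl
  ext ⟨a, o⟩
  refine congrFun (eq_zero_of_emitMean_eq_zero (h a) (y := fun o => b (a, o)) ?_) o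
  ext s
  simp [key, hV]

end completeness

end POMDP

end ConfoundedPOMDP

/-! ### The efficiency bound -/

theorem mainTheorem7 {S A O : Type*} [Fintype S] [Fintype A] [Fintype O] {Rw : Finset ℝ}
    (M : ConfoundedPOMDP.POMDP S A O Rw)
    (pe : O → A → ℝ) (hpe : ∀ o, pe o ∈ stdSimplex ℝ A)
    (pb : S → A → ℝ) (hpb : ∀ s, pb s ∈ stdSimplex ℝ A)
    (d : O × S → ℝ) (hd : d ∈ stdSimplex ℝ (O × S))
    (hcard : Fintype.card S = Fintype.card O)
    (hrank : ∀ a, (ConfoundedPOMDP.condMatrix (M.obsLaw d pb) a).rank = Fintype.card S) :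
    -- the law of the observed data lies in the model, and the estimand there is the policy value
    M.obsLaw d pb ∈ ConfoundedPOMDP.observedModel M.disc pe M.initObs ∧
    ConfoundedPOMDP.valueFunctional M.disc pe M.initObs (M.obsLaw d pb) = M.policyValue pe ∧
    -- the estimand is differentiable along every regular submodel
    (∀ p : ℝ → ConfoundedPOMDP.Obs A O Rw → ℝ,
      Efficiency.IsRegularSubmodel (ConfoundedPOMDP.observedModel M.disc pe M.initObs)
        (M.obsLaw d pb) p →
      DifferentiableAt ℝ
        (fun θ => ConfoundedPOMDP.valueFunctional M.disc pe M.initObs (p θ)) 0) ∧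
    -- the Cramér–Rao bound is the variance of `J(b_W, b_V)`
    ∀ bW bV : A → O → ℝ,
      ConfoundedPOMDP.IsWeightBridge M.disc pe M.initObs (M.obsLaw d pb) bW →
      ConfoundedPOMDP.IsValueBridge M.disc pe (M.obsLaw d pb) bV →
      Efficiency.cramerRaoBound (ConfoundedPOMDP.observedModel M.disc pe M.initObs)
          (ConfoundedPOMDP.valueFunctional M.disc pe M.initObs) (M.obsLaw d pb) =
        ENNReal.ofReal (Efficiency.expect (M.obsLaw d pb) (fun x =>
          (ConfoundedPOMDP.drFun M.disc pe M.initObs bW bV x - M.policyValue pe) ^ 2)) := by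
  classical
  have hu : ∀ a, IsUnit (ConfoundedPOMDP.condMatrix (M.obsLaw d pb) a) := fun a =>
    Matrix.isUnit_of_rank_eq_card ((hrank a).trans hcard)
  have hpos : ∀ a j, ConfoundedPOMDP.probAOm (M.obsLaw d pb) a j ≠ 0 :=
    fun a => ConfoundedPOMDP.probAOm_ne_zero_of_isUnit (hu a)
  have hdet : (ConfoundedPOMDP.bridgeMatrix M.disc pe (M.obsLaw d pb)).det ≠ 0 := by
    refine IsUnit.ne_zero ((Matrix.isUnit_iff_isUnit_det _).1
      (Matrix.mulVec_injective_iff_isUnit.1 ?_))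
    convert ConfoundedPOMDP.POMDP.bridgeOp_obsLaw_injective hpe hcard hu using 1
    ext1 f
    exact ConfoundedPOMDP.bridgeMatrix_mulVec _ _ _ f
  have hmem : M.obsLaw d pb ∈ ConfoundedPOMDP.observedModel M.disc pe M.initObs :=
    ConfoundedPOMDP.mem_observedModel (M.obsLaw_mem hd hpb) hu hdet
  have hJ : ∀ b, ConfoundedPOMDP.bridgeOp M.disc pe (M.obsLaw d pb) b =
      ConfoundedPOMDP.rewardVec pe (M.obsLaw d pb) →
      ConfoundedPOMDP.initMean M.initObs b = M.policyValue pe := fun b hb => by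
    rw [ConfoundedPOMDP.POMDP.initMean_initObs,
      M.policyValue_eq hpe (ConfoundedPOMDP.POMDP.bridgeValue_eq hcard hu hb)]
  have hsub : ConfoundedPOMDP.observedModel M.disc pe M.initObs ⊆
      stdSimplex ℝ (ConfoundedPOMDP.Obs A O Rw) := fun p hp => hp.1
  refine ⟨hmem, ?_, fun p hp => ?_, fun bW bV hW hV => ?_⟩
  · rw [ConfoundedPOMDP.valueFunctional_eq hpos hdet]
    exact hJ _ ((ConfoundedPOMDP.bridgeOp_eq_rewardVec_iff hdet _).2 rfl)
  · obtain ⟨p', hp', -⟩ := hp.exists_hasDerivAt hsub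
    obtain ⟨bV, hV, -⟩ := hmem.2.2.1
    obtain ⟨bW, hW, -⟩ := hmem.2.2.2
    rw [← hp.at_zero] at hW hV hdet
    exact (ConfoundedPOMDP.hasDerivAt_valueFunctional M.disc_lt_one.ne hp' hp.mem hdet hW
      hV).differentiableAt
  · have hV' := (ConfoundedPOMDP.isValueBridge_iff hpos bV).1 hV
    refine Efficiency.cramerRaoBound_eq_of_gradient hsub
      (ConfoundedPOMDP.observedModel_mem_nhdsWithin hu hdet) hmem.1 ?_ fun p p' h0 hp' hp => ?_
    -- Centring: `drFun` is `J(πᵉ)` plus a multiple of a residual whose mean is zero by the value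
    -- bridge equation.
    · have h := ConfoundedPOMDP.expect_weightedResidual M.disc pe (Function.uncurry bW)
        (Function.uncurry bV) (M.obsLaw d pb)
      rw [hV', sub_self] at h
      unfold Efficiency.expect at h ⊢
      simp only [ConfoundedPOMDP.drFun_eq, hJ _ hV', add_sub_cancel_left,
        mul_left_comm _ (1 - M.disc)⁻¹, ← Finset.mul_sum, h, mul_zero]
    -- Subtracting the constant `J(πᵉ)` leaves the gradient pairing unchanged, since `p'` sums to
    -- zero.
    · rw [← h0] at hW hV hdet
      have h := ConfoundedPOMDP.hasDerivAt_valueFunctional M.disc_lt_one.ne hp' hp hdet hW hV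
      have hs := Efficiency.sum_deriv_eq_zero hp' (hp.mono fun θ h => h.1)
      simpa only [mul_sub, Finset.sum_sub_distrib, ← Finset.sum_mul, hs, zero_mul, sub_zero] using h
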